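/- Let $\Lambda$ be the set of convex, $1$-Lipschitz functions $\ell:[0,1]\to\mathbb R$. For $p_1,\dots,p_T\in[0,1]$ and $\ell_1,\dots,\ell_T\in\Lambda$ define the swap regret $$\mathsf{SR}(p_{1:T};\ell_{1:T})=\sup_{\sigma:[0,1]\to[0,1]}\Big(\sum_{t=1}^T\ell_t(p_t)-\sum_{t=1}^T\ell_t(\sigma(p_t))\Big),$$ where the supremum is over all functions $\sigma$. Consider the following $T$-round game. In each round $t=1,\dots,T$: (1) the predictor chooses a probability distribution $\rho_t$ on $[0,1]$, depending on the transcript $(p_1,\dots,p_{t-1};\ell_1,\dots,\ell_{t-1})$ of the previous rounds; (2) the adversary, who knows the predictor's strategy and the transcript (hence also $\rho_t$) and may randomize, reveals a loss $\ell_t\in\Lambda$; (3) the prediction $p_t$ is drawn from $\rho_t$, that is, conditionally on the past transcript and on $\ell_t$, the distribution of $p_t$ is $\rho_t$. A prediction strategy is a choice of a (measurable) map from transcripts to distributions $\rho_t$ for every round $t$. Theorem. There is an absolute constant $C>0$ such that for every integer $T\ge 2$ there exists a prediction strategy which guarantees, against every such (adaptive, possibly randomized) adversary, $$\mathbb E\big[\mathsf{SR}(p_{1:T};\ell_{1:T})\big]\le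 C\sqrt T\,\log T .$$ -/

import Mathlib

open MeasureTheory ProbabilityTheory

namespace SwapRegret

/-- The `1`-Lipschitz convex losses `ℓ : [0,1] → ℝ`. Convexity is Mathlib's `ConvexOn` on the set
`[0,1] ⊆ ℝ`, for the extension of `ℓ` to `ℝ` (whose values outside `[0,1]` are irrelevant).
The σ-algebra is the one inherited from `unitInterval → ℝ`, generated by the evaluations
`ℓ ↦ ℓ x`; on these (continuous) functions it is the Borel σ-algebra of the uniform norm. -/
abbrev Loss : Type :=
  {ℓ : unitInterval → ℝ // LipschitzWith 1 ℓ ∧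
    ConvexOn ℝ (Set.Icc (0 : ℝ) 1) (Set.IccExtend (zero_le_one' ℝ) ℓ)}

/-- The swap regret
`SR(p_{1:T}; ℓ_{1:T}) = sup_{σ : [0,1] → [0,1]} (∑ₜ ℓₜ(pₜ) - ∑ₜ ℓₜ(σ(pₜ)))`,
over all functions `σ`. The supremum is over a nonempty set of reals bounded above by `T`. -/
noncomputable def swapRegret {T : ℕ} (p : Fin T → unitInterval) (ℓ : Fin T → Loss) : ℝ :=
  ⨆ σ : unitInterval → unitInterval, (∑ t, (ℓ t).1 (p t) - ∑ t, (ℓ t).1 (σ (p t)))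

/-- Transcripts `(p_1, …, p_t; ℓ_1, …, ℓ_t)` of `t` rounds. -/
abbrev History (t : ℕ) : Type := (Fin t → unitInterval) × (Fin t → Loss)

/-- A randomized prediction strategy for `T` rounds: in each round the predictor chooses a
probability distribution on `[0,1]`, as a (measurable) function of the transcript of the previous
rounds. Rounds are numbered `0, …, T - 1`, so that round `t` is preceded by `t` rounds. -/
structure PredictionStrategy (T : ℕ) where
  /-- the distribution `ρ t h` chosen in round `t` after the transcript `h` -/
  ρ : (t : Fin T) → Kernel (History t) unitInterval
  markov : ∀ t, IsMarkovKernel (ρ t)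

/-- The random transcript of the rounds before round `t`. -/
def past {T : ℕ} {Ω : Type*} (p : Fin T → Ω → unitInterval) (ℓ : Fin T → Ω → Loss)
    (t : Fin T) (ω : Ω) : History t :=
  (fun s => p (s.castLE t.isLt.le) ω, fun s => ℓ (s.castLE t.isLt.le) ω)

/-- `(p, ℓ)` is a random play of the `T`-round game in which the predictor uses the strategy `S`
and the adversary is arbitrary (adaptive, possibly randomized, knowing `S`, hence also the
distribution chosen in the current round): in every round `t`, after the loss `ℓ t` has been
fixed, the prediction `p t` is drawn from the distribution `S.ρ t (past p ℓ t)`. That is, the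
conditional distribution of `p t` given the past transcript and `ℓ t` is `S.ρ t (past p ℓ t)`.
Nothing is assumed about how `ℓ t` depends on the past transcript or on further randomness. -/
structure IsPlay {T : ℕ} (S : PredictionStrategy T) {Ω : Type*} [MeasurableSpace Ω]
    (P : Measure Ω) (p : Fin T → Ω → unitInterval) (ℓ : Fin T → Ω → Loss) : Prop where
  measurable_prediction : ∀ t, Measurable (p t)
  measurable_loss : ∀ t, Measurable (ℓ t)
  prediction_law : ∀ t,
    HasCondDistrib (p t) (fun ω => (past p ℓ t ω, ℓ t ω)) ((S.ρ t).prodMkRight Loss) P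

end SwapRegret

/-!
The predictions are the midpoints of the dyadic intervals of `[0, 1]` of width at least `2⁻ⁿ`.
Four experts at each midpoint measure one-sided slopes of the losses incurred there; by convexity,
the regret against any swap of that prediction is at most the gain of one of them, up to `O(2⁻ⁿ)`.

Every mixture of losses is again convex and `1`-Lipschitz, so the set where it is within
`θ = 2 · 2⁻ⁿ` of its minimum is an interval of length at least `θ`. A largest dyadic interval
inside it, of width `w` say, has a midpoint all of whose experts lose at least `θ / (12 w)` on
average. This is Blackwell's condition for exponential weights with learning rate `θ / (12 w)`, so
the minimax theorem yields a distribution under which the total weight does not grow in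
expectation, whatever the loss. The initial total weight is the sum of the inverse learning rates.
As the widths at each scale sum to `1`, it is `O(n 2ⁿ)`, and `2ⁿ ≈ √T` balances it against the
error `O(T 2⁻ⁿ)`.
-/

namespace SwapRegret

theorem exists_mem_stdSimplex_forall_sum_mul_nonpos {I B : Type*} [Fintype I] [Fintype B]
    [Nonempty B] (v : I → B → ℝ)
    (hv : ∀ c ∈ stdSimplex ℝ I, ∃ b, ∑ i, c i * v i b ≤ 0) :
    ∃ ρ ∈ stdSimplex ℝ B, ∀ i, ∑ b, ρ b * v i b ≤ 0 := by
  classical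
  rcases isEmpty_or_nonempty I with _ | _
  · exact ⟨_, single_mem_stdSimplex ℝ (Classical.arbitrary B), isEmptyElim⟩
  let payoff : (B → ℝ) →ₗ[ℝ] (I → ℝ) →ₗ[ℝ] ℝ :=
    Matrix.toLinearMap₂' ℝ (Matrix.of fun b i => v i b)
  have payoff_single_left (b : B) (c : I → ℝ) : payoff (Pi.single b 1) c = ∑ i, c i * v i b := by
    simp [payoff, Matrix.toLinearMap₂'_apply, Pi.single_apply]
  have payoff_single_right (ρ : B → ℝ) (i : I) :
      payoff ρ (Pi.single i 1) = ∑ b, ρ b * v i b := by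
    simp [payoff, Matrix.toLinearMap₂'_apply, Pi.single_apply]
  obtain ⟨ρ, hρ, c, hc, hsaddle⟩ := Sion.exists_isSaddlePointOn
    (X := stdSimplex ℝ B) (Y := stdSimplex ℝ I) (f := fun ρ c => payoff ρ c)
    ⟨_, single_mem_stdSimplex ℝ (Classical.arbitrary B)⟩ (convex_stdSimplex ℝ B)
    (isCompact_stdSimplex ℝ B)
    (fun c _ => (payoff.flip c).continuous_of_finiteDimensional.lowerSemicontinuous
      |>.lowerSemicontinuousOn _)
    (fun c _ => ((payoff.flip c).convexOn (convex_stdSimplex ℝ B)).quasiconvexOn)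
    (convex_stdSimplex ℝ I) ⟨_, single_mem_stdSimplex ℝ (Classical.arbitrary I)⟩
    (isCompact_stdSimplex ℝ I)
    (fun ρ _ => (payoff ρ).continuous_of_finiteDimensional.upperSemicontinuous
      |>.upperSemicontinuousOn _)
    (fun ρ _ => ((payoff ρ).concaveOn (convex_stdSimplex ℝ I)).quasiconcaveOn)
  obtain ⟨b, hb⟩ := hv c hc
  refine ⟨ρ, hρ, fun i => ?_⟩
  calc ∑ b, ρ b * v i b = payoff ρ (Pi.single i 1) := (payoff_single_right ρ i).symm
    _ ≤ payoff (Pi.single b 1) c :=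
        hsaddle _ (single_mem_stdSimplex ℝ b) _ (single_mem_stdSimplex ℝ i)
    _ ≤ 0 := (payoff_single_left b c).trans_le hb

theorem exists_mem_stdSimplex_forall_sum_mul_nonpos_of_finset {ι B : Type*} [Fintype B]
    [Nonempty B] (v : ι → B → ℝ)
    (hv : ∀ (s : Finset ι), ∀ c ∈ stdSimplex ℝ s, ∃ b, ∑ i, c i * v i b ≤ 0) :
    ∃ ρ ∈ stdSimplex ℝ B, ∀ i, ∑ b, ρ b * v i b ≤ 0 := by
  have hne := (isCompact_stdSimplex ℝ B).inter_iInter_nonempty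
    (fun i => {ρ : B → ℝ | ∑ b, ρ b * v i b ≤ 0})
    (fun i => isClosed_le (by fun_prop) continuous_const) fun s => by
      obtain ⟨ρ, hρ, h⟩ := exists_mem_stdSimplex_forall_sum_mul_nonpos
        (fun i : s => v i) (hv s)
      exact ⟨ρ, hρ, Set.mem_iInter₂.2 fun i hi => h ⟨i, hi⟩⟩
  obtain ⟨ρ, hρ, h⟩ := hne
  exact ⟨ρ, hρ, fun i => Set.mem_iInter.1 h i⟩

theorem sum_mul_exp_sub_one_nonpos {ι : Type*} [Fintype ι] {c u : ι → ℝ}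
    (hc : c ∈ stdSimplex ℝ ι) (hu : ∀ i, |u i| ≤ 1) {a d : ℝ} (ha : 0 ≤ a) (ha1 : a ≤ 1)
    (hmean : ∑ i, c i * u i ≤ d - a) :
    ∑ i, c i * (Real.exp (a * (u i - d)) - 1) ≤ 0 := by
  have exp_le (i : ι) : Real.exp (a * u i) ≤ 1 + a * u i + a ^ 2 := by
    have hau : |a * u i| ≤ a := by
      rw [abs_mul, abs_of_nonneg ha]
      exact mul_le_of_le_one_right ha (hu i)
    have := (abs_le.1 (Real.abs_exp_sub_one_sub_id_le (hau.trans ha1))).2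
    have := sq_le_sq.2 (hau.trans (le_abs_self a))
    linarith
  have hsum : ∑ i, c i * Real.exp (a * u i) ≤ Real.exp (a * d) :=
    calc ∑ i, c i * Real.exp (a * u i) ≤ ∑ i, c i * (1 + a * u i + a ^ 2) :=
          Finset.sum_le_sum fun i _ => mul_le_mul_of_nonneg_left (exp_le i) (hc.1 i)
      _ = ∑ i, c i + a * ∑ i, c i * u i + (∑ i, c i) * a ^ 2 := by
          simp only [Finset.mul_sum, Finset.sum_mul, ← Finset.sum_add_distrib]
          exact Finset.sum_congr rfl fun i _ => by ring
      _ ≤ 1 + a * (d - a) + 1 * a ^ 2 := by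
          rw [hc.2]
          gcongr
      _ = a * d + 1 := by ring
      _ ≤ Real.exp (a * d) := Real.add_one_le_exp _
  have key : ∑ i, c i * Real.exp (a * (u i - d)) ≤ 1 :=
    calc ∑ i, c i * Real.exp (a * (u i - d))
        = (∑ i, c i * Real.exp (a * u i)) / Real.exp (a * d) := by
          simp only [Finset.sum_div, mul_sub, Real.exp_sub, mul_div_assoc]
      _ ≤ 1 := (div_le_one (Real.exp_pos _)).2 hsum
  simpa only [mul_sub, mul_one, Finset.sum_sub_distrib, hc.2, sub_nonpos] using key

/-- The dyadic subintervals `[i / 2 ^ k, (i + 1) / 2 ^ k]` of `[0, 1]` with `k ≤ n`, encoded as the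
pairs `⟨k, i⟩`. Each of them stands for one possible prediction, its midpoint. -/
abbrev Bucket (n : ℕ) : Type := Σ k : Fin (n + 1), Fin (2 ^ (k : ℕ))

theorem eq_and_eq_of_odd_mul_two_pow_eq {a b k m : ℕ} (ha : Odd a) (hb : Odd b)
    (h : a * 2 ^ k = b * 2 ^ m) : a = b ∧ k = m := by
  have coprime {c : ℕ} (hc : Odd c) (e : ℕ) : c.Coprime (2 ^ e) :=
    (Nat.coprime_two_right.2 hc).pow_right e
  have hab : a = b := Nat.dvd_antisymm
    ((coprime ha m).dvd_of_dvd_mul_right (h ▸ dvd_mul_right a _))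
    ((coprime hb k).dvd_of_dvd_mul_right (h ▸ dvd_mul_right b _))
  subst hab
  exact ⟨rfl, Nat.pow_right_injective le_rfl (Nat.eq_of_mul_eq_mul_left ha.pos h)⟩

namespace Bucket

variable {n : ℕ} (b : Bucket n)

/-- The length `2⁻ᵏ` of a dyadic interval. -/
noncomputable def width : ℝ := (1 / 2) ^ (b.1 : ℕ)

/-- The midpoint of a dyadic interval. -/
noncomputable def center : ℝ := ((b.2 : ℕ) + 1 / 2) * b.width

theorem width_pos : 0 < b.width := by unfold width; positivity

theorem center_sub_half_width : b.center - b.width / 2 = (b.2 : ℕ) * b.width := by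
  unfold center; ring

theorem center_add_half_width : b.center + b.width / 2 = ((b.2 : ℕ) + 1) * b.width := by
  unfold center; ring

theorem Icc_subset_Icc_zero_one :
    Set.Icc (b.center - b.width / 2) (b.center + b.width / 2) ⊆ Set.Icc 0 1 := by
  rw [center_sub_half_width, center_add_half_width]
  refine Set.Icc_subset_Icc (mul_nonneg (Nat.cast_nonneg _) b.width_pos.le) ?_
  have hi : ((b.2 : ℕ) : ℝ) + 1 ≤ 2 ^ (b.1 : ℕ) := by exact_mod_cast b.2.isLt
  calc (((b.2 : ℕ) : ℝ) + 1) * b.width ≤ 2 ^ (b.1 : ℕ) * (1 / 2) ^ (b.1 : ℕ) :=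
        mul_le_mul_of_nonneg_right hi b.width_pos.le
    _ = 1 := by rw [← mul_pow]; norm_num

theorem center_mem_Icc : b.center ∈ Set.Icc (0 : ℝ) 1 :=
  b.Icc_subset_Icc_zero_one ⟨by linarith [b.width_pos], by linarith [b.width_pos]⟩

/-- The midpoint of a dyadic interval, as a prediction. -/
noncomputable def point : unitInterval := ⟨b.center, b.center_mem_Icc⟩

theorem center_eq_div : b.center = (2 * (b.2 : ℕ) + 1 : ℕ) / (2 ^ ((b.1 : ℕ) + 1) : ℕ) := by
  simp only [center, width, one_div, inv_pow]
  push_cast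
  field_simp
  ring

theorem point_injective : Function.Injective (point : Bucket n → unitInterval) := by
  rintro ⟨k, i⟩ ⟨m, j⟩ h
  have hdiv : ((2 * i + 1 : ℕ) : ℝ) / (2 ^ ((k : ℕ) + 1) : ℕ)
      = (2 * j + 1 : ℕ) / (2 ^ ((m : ℕ) + 1) : ℕ) := by
    simpa only [point, center_eq_div] using congrArg Subtype.val h
  rw [div_eq_div_iff (by positivity) (by positivity)] at hdiv
  obtain ⟨hij, hkm⟩ := eq_and_eq_of_odd_mul_two_pow_eq (odd_two_mul_add_one _)
    (odd_two_mul_add_one _) (by exact_mod_cast hdiv)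
  obtain rfl : k = m := Fin.ext (by omega)
  obtain rfl : i = j := Fin.ext (by omega)
  rfl

theorem sum_width (n : ℕ) : ∑ b : Bucket n, b.width = n + 1 := by
  simp [Fintype.sum_sigma, width]

end Bucket

theorem exists_nat_Icc_subset_of_ordConnected {s : Set ℝ} (hs : s.OrdConnected)
    (hs0 : s ⊆ Set.Ici 0) {x y δ : ℝ} (hx : x ∈ s) (hy : y ∈ s) (hδ : 0 < δ)
    (hxy : 2 * δ ≤ |y - x|) : ∃ i : ℕ, Set.Icc (i * δ) ((i + 1) * δ) ⊆ s := by
  wlog hle : x ≤ y generalizing x y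
  · exact this hy hx (by rwa [abs_sub_comm]) (le_of_not_ge hle)
  rw [abs_of_nonneg (sub_nonneg.2 hle)] at hxy
  refine ⟨⌈x / δ⌉₊, (Set.Icc_subset_Icc ?_ ?_).trans (hs.out hx hy)⟩
  · exact (div_le_iff₀ hδ).1 (Nat.le_ceil _)
  · have := mul_lt_mul_of_pos_right (Nat.ceil_lt_add_one (div_nonneg (hs0 hx) hδ.le)) hδ
    rw [add_mul, div_mul_cancel₀ x hδ.ne'] at this
    linarith

theorem exists_bucket_subset_and_near {n : ℕ} {s : Set ℝ} (hs : s.OrdConnected)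
    (hs01 : s ⊆ Set.Icc 0 1) {x y : ℝ} (hx : x ∈ s) (hy : y ∈ s)
    (hxy : 2 * (1 / 2) ^ n ≤ |y - x|) :
    ∃ b : Bucket n, Set.Icc (b.center - b.width / 2) (b.center + b.width / 2) ⊆ s ∧
      ∀ z ∈ s, |z - b.center| < 4 * b.width := by
  classical
  let Fits (k : ℕ) : Prop := ∃ i : ℕ, Set.Icc (i * (1 / 2 : ℝ) ^ k) ((i + 1) * (1 / 2) ^ k) ⊆ s
  have fits {k : ℕ} {x y : ℝ} (hx : x ∈ s) (hy : y ∈ s) (hxy : 2 * (1 / 2) ^ k ≤ |y - x|) :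
      Fits k :=
    exists_nat_Icc_subset_of_ordConnected hs (fun _ hz => (hs01 hz).1) hx hy (by positivity) hxy
  obtain ⟨k, ⟨i, hi⟩, hmin⟩ : ∃ k, Fits k ∧ ∀ m < k, ¬ Fits m :=
    have hex : ∃ k, Fits k := ⟨n, fits hx hy hxy⟩
    ⟨Nat.find hex, Nat.find_spec hex, fun _ => Nat.find_min hex⟩
  have hkn : k ≤ n := not_lt.1 fun hnk => hmin n hnk (fits hx hy hxy)
  have hi_lt : i < 2 ^ k := by
    have hright := (hs01 (hi (Set.right_mem_Icc.2 (by gcongr; linarith)))).2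
    rw [one_div, inv_pow, ← div_eq_mul_inv, div_le_one (by positivity)] at hright
    exact_mod_cast hright
  let b : Bucket n := ⟨⟨k, by omega⟩, ⟨i, hi_lt⟩⟩
  have hb : Set.Icc (b.center - b.width / 2) (b.center + b.width / 2) ⊆ s := by
    rwa [b.center_sub_half_width, b.center_add_half_width]
  have hc : b.center ∈ s := hb ⟨by linarith [b.width_pos], by linarith [b.width_pos]⟩
  refine ⟨b, hb, fun z hz => not_le.1 fun hfar => ?_⟩
  rcases k with _ | k
  · have hwidth : b.width = 1 := pow_zero _
    linarith [abs_sub_le_of_le_of_le (hs01 hz).1 (hs01 hz).2 (hs01 hc).1 (hs01 hc).2]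
  · refine hmin k k.lt_succ_self (fits hc hz (le_trans (le_of_eq ?_) hfar))
    change _ = 4 * (1 / 2 : ℝ) ^ (k + 1)
    ring

theorem exists_mem_Icc_le_abs_sub {m θ : ℝ} (hm : m ∈ Set.Icc (0 : ℝ) 1) (hθ0 : 0 < θ)
    (hθ1 : θ ≤ 1) :
    ∃ x ∈ Set.Icc (0 : ℝ) 1, ∃ y ∈ Set.Icc (0 : ℝ) 1,
      |x - m| ≤ θ ∧ |y - m| ≤ θ ∧ θ ≤ |y - x| := by
  obtain ⟨hm0, hm1⟩ := hm
  rcases le_total m θ with h | h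
  · exact ⟨0, ⟨le_rfl, zero_le_one⟩, θ, ⟨hθ0.le, hθ1⟩, abs_le.2 ⟨by linarith, by linarith⟩,
      abs_le.2 ⟨by linarith, by linarith⟩, by rw [sub_zero, abs_of_pos hθ0]⟩
  · exact ⟨m - θ, ⟨by linarith, by linarith⟩, m, ⟨hm0, hm1⟩,
      by rw [sub_sub_cancel_left, abs_neg, abs_of_pos hθ0], by simpa using hθ0.le,
      by rw [sub_sub_cancel, abs_of_pos hθ0]⟩

theorem exists_bucket_of_convexOn {f : ℝ → ℝ} (hf : ConvexOn ℝ (Set.Icc 0 1) f)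
    (hlip : LipschitzOnWith 1 f (Set.Icc 0 1)) {n : ℕ} {θ : ℝ} (hθ : 2 * (1 / 2) ^ n ≤ θ)
    (hθ1 : θ ≤ 1) :
    ∃ b : Bucket n,
      (∀ z, |z - b.center| ≤ b.width / 2 → f z ≤ f b.center + θ) ∧
      ∀ z ∈ Set.Icc 0 1, 12 * b.width ≤ |z - b.center| → f b.center + θ ≤ f z := by
  obtain ⟨m, hm, hmin⟩ := isCompact_Icc.exists_isMinOn (Set.nonempty_Icc.2 zero_le_one)
    hlip.continuousOn
  let s : Set ℝ := {x ∈ Set.Icc 0 1 | f x ≤ f m + θ}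
  have hθ0 : 0 < θ := lt_of_lt_of_le (by positivity) hθ
  have mem_s_of_near {x : ℝ} (hx : x ∈ Set.Icc (0 : ℝ) 1) (hxm : |x - m| ≤ θ) : x ∈ s := by
    have := hlip.dist_le_mul x hx m hm
    rw [NNReal.coe_one, one_mul, Real.dist_eq, Real.dist_eq] at this
    exact ⟨hx, by linarith [le_abs_self (f x - f m)]⟩
  obtain ⟨x, hx, y, hy, hxm, hym, hxy⟩ := exists_mem_Icc_le_abs_sub hm hθ0 hθ1
  obtain ⟨b, hbs, hnear⟩ := exists_bucket_subset_and_near (hf.convex_le _).ordConnected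
    (Set.sep_subset _ _) (mem_s_of_near hx hxm)
    (mem_s_of_near hy hym) (hθ.trans hxy)
  have hc : f b.center ≤ f m + θ :=
    (hbs ⟨by linarith [b.width_pos], by linarith [b.width_pos]⟩).2
  refine ⟨b, fun z hzb => ?_, fun z hz hzb => ?_⟩
  · have hzs : z ∈ s := hbs (Set.mem_Icc_iff_abs_le.1 (by rwa [abs_sub_comm]))
    linarith [hzs.2, isMinOn_iff.1 hmin b.center b.center_mem_Icc]
  -- The midpoint of `m` and `z` is too far from the bucket to be `θ`-optimal.
  have hmid_mem : (m + z) / 2 ∈ Set.Icc (0 : ℝ) 1 :=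
    ⟨by linarith [hm.1, hz.1], by linarith [hm.2, hz.2]⟩
  have hmid : f m + θ < f ((m + z) / 2) := by
    by_contra! hle
    have hclose := abs_lt.1 (hnear _ ⟨hmid_mem, hle⟩)
    have hm_close := abs_lt.1 (hnear m (mem_s_of_near hm (by simpa using hθ0.le)))
    rcases le_abs.1 hzb with h | h <;> linarith
  have hconv : f ((m + z) / 2) ≤ (f m + f z) / 2 := by
    have := hf.2 hm hz one_half_pos.le one_half_pos.le (add_halves 1)
    simp only [smul_eq_mul] at this
    rw [show 1 / 2 * m + 1 / 2 * z = (m + z) / 2 by ring] at this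
    linarith
  linarith

theorem exists_units_mul_abs_eq (x : ℝ) : ∃ ε : ℤˣ, ε * |x| = x := by
  rcases abs_cases x with ⟨h, _⟩ | ⟨h, _⟩
  · exact ⟨1, by simp [h]⟩
  · exact ⟨-1, by simp [h]⟩

section Decrease

/-- The average decrease of `f` per unit length from `x` to the point at signed distance `δ` in the
direction `ε`. For a negative `δ` it is measured behind `x`, still in the direction `ε`. -/
noncomputable def decrease (f : ℝ → ℝ) (x : ℝ) (ε : ℤˣ) (δ : ℝ) : ℝ := (f x - f (x + ε * δ)) / δ

variable {f : ℝ → ℝ} (x : ℝ) (ε : ℤˣ) (δ : ℝ)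

theorem abs_units_mul : |(ε : ℝ) * δ| = |δ| := by
  rcases Int.units_eq_one_or ε with rfl | rfl <;> simp

theorem abs_add_units_mul_sub : |x + ε * δ - x| = |δ| := by
  rw [add_sub_cancel_left, abs_units_mul]

theorem decrease_eq_neg_mul_slope : decrease f x ε δ = -(ε * slope f x (x + ε * δ)) := by
  rw [decrease, slope_def_field, add_sub_cancel_left]
  rcases Int.units_eq_one_or ε with rfl | rfl <;> push_cast <;> ring

theorem abs_decrease_le {K : NNReal} (hf : LipschitzWith K f) : |decrease f x ε δ| ≤ K := by
  rw [decrease, abs_div, abs_sub_comm, ← abs_add_units_mul_sub x ε δ]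
  exact div_le_of_le_mul₀ (abs_nonneg _) K.2 (hf.dist_le_mul (x + ε * δ) x)

theorem decrease_sum_mul {ι : Type*} [Fintype ι] (c : ι → ℝ) (f : ι → ℝ → ℝ) :
    decrease (fun z => ∑ i, c i * f i z) x ε δ = ∑ i, c i * decrease (f i) x ε δ := by
  simp only [decrease, ← Finset.sum_sub_distrib, Finset.sum_div, ← mul_sub, mul_div_assoc]

variable {x δ} in
theorem sub_le_mul_decrease {s : Set ℝ} (hf : ConvexOn ℝ s f) {a : ℝ} (hx : x ∈ s)
    (hδs : x + ε * δ ∈ s) (has : x + ε * a ∈ s) (hδ : δ ≠ 0) (ha : 0 ≤ a) (hδa : δ ≤ a) :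
    f x - f (x + ε * a) ≤ a * decrease f x ε δ := by
  rcases ha.eq_or_lt with rfl | ha
  · simp
  have hdecrease : decrease f x ε a ≤ decrease f x ε δ := by
    have hδ_ne : x + ε * δ ∈ s \ {x} := ⟨hδs, by simpa using hδ⟩
    have ha_ne : x + ε * a ∈ s \ {x} := ⟨has, by simpa using ha.ne'⟩
    rw [decrease_eq_neg_mul_slope, decrease_eq_neg_mul_slope]
    rcases Int.units_eq_one_or ε with rfl | rfl
    · simpa using hf.slope_mono hx hδ_ne ha_ne (by simpa using hδa)
    · simpa using hf.slope_mono hx ha_ne hδ_ne (by push_cast; linarith)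
  calc f x - f (x + ε * a) = a * decrease f x ε a := (mul_div_cancel₀ _ ha.ne').symm
    _ ≤ a * decrease f x ε δ := mul_le_mul_of_nonneg_left hdecrease ha.le

end Decrease

/-- The extension of a loss to the real line, constant outside `[0, 1]`. -/
noncomputable def Loss.extend (ℓ : Loss) : ℝ → ℝ := Set.IccExtend (zero_le_one' ℝ) ℓ.1

namespace Loss

instance : Nonempty Loss :=
  ⟨⟨fun _ => 0, LipschitzWith.const' 0, convexOn_const 0 (convex_Icc 0 1)⟩⟩

theorem extend_coe (ℓ : Loss) (x : unitInterval) : ℓ.extend x = ℓ.1 x :=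
  Set.IccExtend_val (zero_le_one' ℝ) ℓ.1 x

theorem lipschitzWith_extend (ℓ : Loss) : LipschitzWith 1 ℓ.extend :=
  one_mul (1 : NNReal) ▸ ℓ.2.1.comp (LipschitzWith.projIcc (zero_le_one' ℝ))

theorem measurable_extend_apply (x : ℝ) : Measurable fun ℓ : Loss => ℓ.extend x :=
  (measurable_pi_apply (Set.projIcc 0 1 (zero_le_one' ℝ) x)).comp measurable_subtype_coe

theorem sub_le_one (ℓ : Loss) (x y : unitInterval) : ℓ.1 x - ℓ.1 y ≤ 1 :=
  calc ℓ.1 x - ℓ.1 y ≤ dist (ℓ.1 x) (ℓ.1 y) := le_abs_self _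
    _ ≤ dist x y := by simpa only [NNReal.coe_one, one_mul] using ℓ.2.1.dist_le_mul x y
    _ ≤ 1 := by simpa only [sub_zero] using! Real.dist_le_of_mem_Icc x.2 y.2

theorem measurable_eval : Measurable fun z : Loss × unitInterval => z.1.1 z.2 :=
  (measurable_uncurry_of_continuous_of_measurable (u := fun x (ℓ : Loss) => ℓ.1 x)
    (fun ℓ => ℓ.2.1.continuous)
    (fun x => (measurable_pi_apply x).comp measurable_subtype_coe)).comp measurable_swap

end Loss

section Regret

variable {T : ℕ} (p : Fin T → unitInterval) (ℓ : Fin T → Loss)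

theorem sum_sub_sum_swap_le (σ : unitInterval → unitInterval) :
    ∑ t, (ℓ t).1 (p t) - ∑ t, (ℓ t).1 (σ (p t)) ≤ T := by
  rw [← Finset.sum_sub_distrib]
  exact (Finset.sum_le_sum fun t _ => (ℓ t).sub_le_one _ _).trans (by simp)

theorem swapRegret_mem_Icc : swapRegret p ℓ ∈ Set.Icc (0 : ℝ) T := by
  refine ⟨?_, ciSup_le (sum_sub_sum_swap_le p ℓ)⟩
  have hbdd : BddAbove (Set.range fun σ : unitInterval → unitInterval =>
      ∑ t, (ℓ t).1 (p t) - ∑ t, (ℓ t).1 (σ (p t))) :=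
    ⟨T, Set.forall_mem_range.2 (sum_sub_sum_swap_le p ℓ)⟩
  exact (sub_self _).symm.trans_le (le_ciSup hbdd id)

-- A swap function only matters through its values on the level sets of `p`.
theorem swapRegret_eq_iSup_levelSet : swapRegret p ℓ =
    ⨆ q : Set (Fin T) → unitInterval, (∑ t, (ℓ t).1 (p t) - ∑ t, (ℓ t).1 (q {s | p s = p t})) := by
  refine congrArg sSup (Set.Subset.antisymm ?_ ?_)
  · rintro _ ⟨σ, rfl⟩
    classical
    let q (A : Set (Fin T)) : unitInterval := if hA : A.Nonempty then σ (p hA.some) else 0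
    have hq (t : Fin T) : q {s | p s = p t} = σ (p t) := by
      have hA : {s | p s = p t}.Nonempty := ⟨t, rfl⟩
      exact (dif_pos hA).trans (congrArg σ hA.some_mem)
    exact ⟨q, by simp only [hq]⟩
  · rintro _ ⟨q, rfl⟩
    exact ⟨fun x => q {s | p s = x}, rfl⟩

theorem swapRegret_eq_iSup_denseSeq : swapRegret p ℓ =
    ⨆ q : Set (Fin T) → ℕ, (∑ t, (ℓ t).1 (p t) -
      ∑ t, (ℓ t).1 (TopologicalSpace.denseSeq unitInterval (q {s | p s = p t}))) := by
  have hcont : Continuous fun q : Set (Fin T) → unitInterval =>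
      ∑ t, (ℓ t).1 (p t) - ∑ t, (ℓ t).1 (q {s | p s = p t}) :=
    continuous_const.sub <| continuous_finsetSum _ fun t _ =>
      (ℓ t).2.1.continuous.comp (continuous_apply _)
  have hdense : DenseRange
      (Pi.map fun (_ : Set (Fin T)) => TopologicalSpace.denseSeq unitInterval) :=
    DenseRange.piMap fun _ => TopologicalSpace.denseRange_denseSeq unitInterval
  rw [swapRegret_eq_iSup_levelSet, ← hdense.ciSup' hcont]
  exact (Set.rangeFactorization_surjective.iSup_comp (g := fun q : Set.range
    (Pi.map fun (_ : Set (Fin T)) => TopologicalSpace.denseSeq unitInterval) =>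
    ∑ t, (ℓ t).1 (p t) - ∑ t, (ℓ t).1 (q.1 {s | p s = p t}))).symm

theorem measurable_swapRegret : Measurable fun h : History T => swapRegret h.1 h.2 := by
  have measurable_apply {x : History T → unitInterval} (hx : Measurable x) (t : Fin T) :
      Measurable fun h : History T => (h.2 t).1 (x h) :=
    Loss.measurable_eval.comp (((measurable_pi_apply t).comp measurable_snd).prodMk hx)
  have measurable_prediction (t : Fin T) : Measurable fun h : History T => h.1 t :=
    (measurable_pi_apply t).comp measurable_fst
  have measurable_levelSet (t : Fin T) :
      Measurable fun h : History T => {s | h.1 s = h.1 t} :=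
    measurable_set_iff.2 fun s =>
      measurableSet_setOfPred.1
        (measurableSet_eq_fun (measurable_prediction s) (measurable_prediction t))
  simp only [swapRegret_eq_iSup_denseSeq]
  refine Measurable.iSup fun q => Measurable.sub ?_ ?_
  · exact Finset.measurable_sum _ fun t _ => measurable_apply (measurable_prediction t) t
  · exact Finset.measurable_sum _ fun t _ =>
      measurable_apply ((measurable_of_countable fun A =>
        TopologicalSpace.denseSeq unitInterval (q A)).comp (measurable_levelSet t)) t

theorem integrable_swapRegret {Ω : Type*} [MeasurableSpace Ω] {P : Measure Ω} [IsFiniteMeasure P]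
    {p : Fin T → Ω → unitInterval} {ℓ : Fin T → Ω → Loss} (hp : ∀ t, Measurable (p t))
    (hℓ : ∀ t, Measurable (ℓ t)) :
    Integrable (fun ω => swapRegret (fun t => p t ω) (fun t => ℓ t ω)) P :=
  Integrable.of_mem_Icc 0 T
    (measurable_swapRegret.comp
      ((measurable_pi_lambda _ hp).prodMk (measurable_pi_lambda _ hℓ))).aemeasurable
    (ae_of_all _ fun _ => swapRegret_mem_Icc _ _)

end Regret

section HasCondDistrib

variable {Ω α β : Type*} [MeasurableSpace Ω] [MeasurableSpace α] [MeasurableSpace β]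
  {P : Measure Ω} {X : Ω → α} {Y : Ω → β} {κ : Kernel α β}

theorem ae_mem_of_hasCondDistrib (h : HasCondDistrib Y X κ P) {s : Set β} (hs : MeasurableSet s)
    (h_ae : ∀ a, ∀ᵐ y ∂κ a, y ∈ s) : ∀ᵐ ω ∂P, Y ω ∈ s := by
  have hlaw : ∀ᵐ z ∂(P.map fun ω => (X ω, Y ω)), z.2 ∈ s := by
    rw [h.map_eq]
    exact Measure.ae_compProd_of_ae_ae (measurable_snd hs) (ae_of_all _ h_ae)
  exact ae_of_ae_map h.aemeasurable hlaw

theorem integral_le_integral_of_hasCondDistrib [SFinite P] [IsSFiniteKernel κ]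
    (h : HasCondDistrib Y X κ P) {g : α × β → ℝ}
    (hg : Measurable g) (hg_int : Integrable (fun ω => g (X ω, Y ω)) P) {ψ : α → ℝ}
    (hψ : Measurable ψ) (hψ_int : Integrable (fun ω => ψ (X ω)) P)
    (hle : ∀ a, ∫ y, g (a, y) ∂κ a ≤ ψ a) :
    ∫ ω, g (X ω, Y ω) ∂P ≤ ∫ ω, ψ (X ω) ∂P := by
  have hX := h.aemeasurable_fst
  have hg_int' : Integrable g (P.map X ⊗ₘ κ) := by
    rwa [← h.map_eq, integrable_map_measure hg.aestronglyMeasurable h.aemeasurable]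
  have hψ_int' : Integrable ψ (P.map X) :=
    (integrable_map_measure hψ.aestronglyMeasurable hX).2 hψ_int
  calc ∫ ω, g (X ω, Y ω) ∂P = ∫ z, g z ∂(P.map X ⊗ₘ κ) := by
        rw [← h.map_eq, integral_map h.aemeasurable hg.aestronglyMeasurable]
    _ = ∫ a, ∫ y, g (a, y) ∂κ a ∂P.map X := Measure.integral_compProd hg_int'
    _ ≤ ∫ a, ψ a ∂P.map X := integral_mono (Integrable.integral_compProd hg_int') hψ_int' hle
    _ = ∫ ω, ψ (X ω) ∂P := integral_map hX hψ.aestronglyMeasurable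

end HasCondDistrib

/-- The transcript `h` extended by a round with prediction `x` and loss `ℓ`. -/
def History.snoc {t : ℕ} (h : History t) (x : unitInterval) (ℓ : Loss) : History (t + 1) :=
  (Fin.snoc h.1 x, Fin.snoc h.2 ℓ)

/-- The random transcript of the first `m` rounds. -/
def transcript {T : ℕ} {Ω : Type*} (p : Fin T → Ω → unitInterval) (ℓ : Fin T → Ω → Loss) {m : ℕ}
    (hm : m ≤ T) (ω : Ω) : History m :=
  (fun s => p (s.castLE hm) ω, fun s => ℓ (s.castLE hm) ω)

theorem measurable_finSnoc {α : Type*} [MeasurableSpace α] {t : ℕ} :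
    Measurable fun z : (Fin t → α) × α => (Fin.snoc z.1 z.2 : Fin (t + 1) → α) := by
  refine measurable_pi_lambda _ fun s => ?_
  induction s using Fin.lastCases with
  | last => simpa only [Fin.snoc_last] using measurable_snd
  | cast s =>
    simp only [Fin.snoc_castSucc]
    exact (measurable_pi_apply s).comp measurable_fst

theorem History.measurable_snoc {t : ℕ} :
    Measurable fun z : (History t × Loss) × unitInterval => z.1.1.snoc z.2 z.1.2 := by
  refine Measurable.prodMk ?_ ?_
  · exact measurable_finSnoc.comp
      ((measurable_fst.comp (measurable_fst.comp measurable_fst)).prodMk measurable_snd)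
  · exact measurable_finSnoc.comp
      ((measurable_snd.comp (measurable_fst.comp measurable_fst)).prodMk
        (measurable_snd.comp measurable_fst))

section Transcript

variable {T : ℕ} {Ω : Type*} {p : Fin T → Ω → unitInterval} {ℓ : Fin T → Ω → Loss}

theorem transcript_succ {m : ℕ} (hm : m + 1 ≤ T) (ω : Ω) :
    transcript p ℓ hm ω =
      (transcript p ℓ (m.le_succ.trans hm) ω).snoc (p ⟨m, hm⟩ ω) (ℓ ⟨m, hm⟩ ω) := by
  refine Prod.ext (funext fun s => ?_) (funext fun s => ?_) <;>
  induction s using Fin.lastCases with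
  | last => simp only [History.snoc, Fin.snoc_last]; rfl
  | cast s => simp only [History.snoc, Fin.snoc_castSucc]; rfl

variable [MeasurableSpace Ω]

theorem measurable_transcript (hp : ∀ t, Measurable (p t)) (hℓ : ∀ t, Measurable (ℓ t)) {m : ℕ}
    (hm : m ≤ T) : Measurable (transcript p ℓ hm) :=
  (measurable_pi_lambda _ fun _ => hp _).prodMk (measurable_pi_lambda _ fun _ => hℓ _)

end Transcript

namespace IsPlay

variable {T : ℕ} {S : PredictionStrategy T} {Ω : Type*} [MeasurableSpace Ω] {P : Measure Ω}
  {p : Fin T → Ω → unitInterval} {ℓ : Fin T → Ω → Loss} (hplay : IsPlay S P p ℓ)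
include hplay

theorem integral_transcript_le [IsProbabilityMeasure P] {Φ : (m : ℕ) → History m → ℝ}
    (hΦ : ∀ m, Measurable (Φ m)) (hΦ_bdd : ∀ m, ∃ K, ∀ h, |Φ m h| ≤ K) {η : ℝ}
    (hstep : ∀ (t : Fin T) (h : History t) (ℓ : Loss),
      ∫ x, Φ (t + 1) (h.snoc x ℓ) ∂S.ρ t h ≤ Φ t h + η) {m : ℕ} (hm : m ≤ T) :
    ∫ ω, Φ m (transcript p ℓ hm ω) ∂P ≤ Φ 0 default + m * η := by
  have integrable {m : ℕ} (hm : m ≤ T) :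
      Integrable (fun ω => Φ m (transcript p ℓ hm ω)) P := by
    obtain ⟨K, hK⟩ := hΦ_bdd m
    exact Integrable.of_bound ((hΦ m).comp (measurable_transcript hplay.measurable_prediction
      hplay.measurable_loss hm)).aestronglyMeasurable K (ae_of_all _ fun _ => hK _)
  induction m with
  | zero => simp [Subsingleton.elim (transcript p ℓ hm _) default]
  | succ m ih =>
    let t : Fin T := ⟨m, hm⟩
    have hΦ_int := integrable hm
    simp only [transcript_succ] at hΦ_int ⊢
    have := S.markov t
    calc ∫ ω, Φ (m + 1) ((past p ℓ t ω).snoc (p t ω) (ℓ t ω)) ∂P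
        ≤ ∫ ω, (Φ m (transcript p ℓ (m.le_succ.trans hm) ω) + η) ∂P :=
          integral_le_integral_of_hasCondDistrib (hplay.prediction_law t)
            (g := fun z => Φ (m + 1) (z.1.1.snoc z.2 z.1.2)) (ψ := fun z => Φ m z.1 + η)
            ((hΦ (m + 1)).comp History.measurable_snoc) hΦ_int
            (((hΦ m).comp measurable_fst).add_const η)
            ((integrable _).add (integrable_const η)) fun z => hstep t z.1 z.2
      _ ≤ Φ 0 default + (m + 1 : ℕ) * η := by
          rw [integral_add (integrable _) (integrable_const η)]
          simp only [integral_const, probReal_univ, one_smul]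
          push_cast
          linarith [ih (m.le_succ.trans hm)]

end IsPlay

theorem abs_sub_floor_div_mul_le {x ε : ℝ} (hx : 0 ≤ x) (hε : 0 < ε) :
    |x - ⌊x / ε⌋₊ * ε| ≤ ε := by
  have hle := (le_div_iff₀ hε).1 (Nat.floor_le (div_nonneg hx hε.le))
  have hlt := (div_lt_iff₀ hε).1 (Nat.lt_floor_add_one (x / ε))
  rw [abs_of_nonneg (sub_nonneg.2 hle)]
  linarith

theorem exists_isProbabilityMeasure_integral_eq_sum {A α : Type*} [Fintype A] [MeasurableSpace α]
    [MeasurableSingletonClass α] {ρ : A → ℝ} (hρ : ρ ∈ stdSimplex ℝ A) (f : A → α) :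
    ∃ μ : Measure α, IsProbabilityMeasure μ ∧ (∀ᵐ x ∂μ, x ∈ Set.range f) ∧
      ∀ g : α → ℝ, Measurable g → ∫ x, g x ∂μ = ∑ a, ρ a * g (f a) := by
  let : MeasurableSpace A := ⊤
  have hf : Measurable f := measurable_from_top
  let μ : PMF A := PMF.ofFintype (fun a => ENNReal.ofReal (ρ a)) (by
    rw [← ENNReal.ofReal_sum_of_nonneg fun a _ => hρ.1 a, hρ.2, ENNReal.ofReal_one])
  refine ⟨μ.toMeasure.map f, Measure.isProbabilityMeasure_map hf.aemeasurable, ?_, fun g hg => ?_⟩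
  · exact (ae_map_iff hf.aemeasurable (Set.finite_range f).measurableSet).2
      (ae_of_all _ Set.mem_range_self)
  · rw [integral_map hf.aemeasurable hg.aestronglyMeasurable, PMF.integral_eq_sum]
    exact Finset.sum_congr rfl fun a _ =>
      congrArg (· * g (f a)) (ENNReal.toReal_ofReal (hρ.1 a))

theorem sum_mul_sum_mul_le_of_abs_sub_le {A J : Type*} [Fintype A] [Fintype J]
    {v w g : A → J → ℝ} {ε G : ℝ} (hvw : ∀ a j, |v a j - w a j| ≤ ε) (hg : ∀ a j, |g a j| ≤ G)
    {ρ : A → ℝ} (hρ : ρ ∈ stdSimplex ℝ A) :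
    ∑ a, ρ a * ∑ j, v a j * g a j ≤
      ∑ a, ρ a * ∑ j, w a j * g a j + Fintype.card J * (ε * G) := by
  have term_le (a : A) (j : J) : v a j * g a j ≤ w a j * g a j + ε * G := by
    have : |(v a j - w a j) * g a j| ≤ ε * G := abs_mul (v a j - w a j) (g a j) ▸
      mul_le_mul (hvw a j) (hg a j) (abs_nonneg _) ((abs_nonneg _).trans (hvw a j))
    linarith [le_abs_self ((v a j - w a j) * g a j), sub_mul (v a j) (w a j) (g a j)]
  calc ∑ a, ρ a * ∑ j, v a j * g a j ≤ ∑ a, ρ a * ∑ j, (w a j * g a j + ε * G) := by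
        gcongr with a _ j _
        · exact hρ.1 a
        · exact term_le a j
    _ = ∑ a, ρ a * ∑ j, w a j * g a j + Fintype.card J * (ε * G) := by
        simp only [Finset.sum_add_distrib, mul_add, ← Finset.sum_mul, hρ.2, Finset.sum_const,
          Finset.card_univ, nsmul_eq_mul, one_mul, mul_assoc]

/-- A family of experts `(a, j)` giving advice to a predictor whose predictions are the numbers
`point a`: in a round with prediction `point a` and loss `ℓ`, the expert `(a, j)` gains
`gain a j ℓ` for every `j`, and no other expert gains anything. The experts at `a` are weighted
multiplicatively with the learning rate `rate a`. -/
structure ExpertFamily (A J : Type*) where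
  point : A → unitInterval
  point_injective : Function.Injective point
  rate : A → ℝ
  rate_pos : ∀ a, 0 < rate a
  gain : A → J → Loss → ℝ
  measurable_gain : ∀ a j, Measurable (gain a j)
  exists_abs_gain_le : ∃ K, ∀ a j ℓ, |gain a j ℓ| ≤ K

namespace ExpertFamily

variable {A J : Type*} (E : ExpertFamily A J)

/-- The total gain of an expert over a transcript. -/
noncomputable def total (a : A) (j : J) {t : ℕ} (h : History t) : ℝ :=
  ∑ s, if h.1 s = E.point a then E.gain a j (h.2 s) else 0

/-- The multiplicative weight of an expert, normalised to start at the inverse learning rate. -/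
noncomputable def weight (a : A) (j : J) {t : ℕ} (h : History t) : ℝ :=
  Real.exp (E.rate a * E.total a j h) / E.rate a

/-- The relative growth of the weight of an expert in a round in which it is consulted. -/
noncomputable def growth (a : A) (j : J) (ℓ : Loss) : ℝ :=
  Real.exp (E.rate a * E.gain a j ℓ) - 1

theorem weight_nonneg (a : A) (j : J) {t : ℕ} (h : History t) : 0 ≤ E.weight a j h :=
  div_nonneg (Real.exp_nonneg _) (E.rate_pos a).le

theorem mul_total_le_weight (a : A) (j : J) {u : ℝ} (hu : u ∈ Set.Icc (0 : ℝ) 1) {t : ℕ}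
    (h : History t) : u * E.total a j h ≤ E.weight a j h := by
  rw [weight, le_div_iff₀ (E.rate_pos a)]
  calc u * E.total a j h * E.rate a = u * (E.rate a * E.total a j h) := by ring
    _ ≤ u * Real.exp (E.rate a * E.total a j h) :=
        mul_le_mul_of_nonneg_left ((le_add_of_nonneg_right zero_le_one).trans
          (Real.add_one_le_exp _)) hu.1
    _ ≤ Real.exp (E.rate a * E.total a j h) := mul_le_of_le_one_left (Real.exp_nonneg _) hu.2

theorem weight_snoc (a : A) (j : J) {t : ℕ} (h : History t) (x : unitInterval) (ℓ : Loss) :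
    E.weight a j (h.snoc x ℓ) =
      E.weight a j h + if x = E.point a then E.weight a j h * E.growth a j ℓ else 0 := by
  simp only [weight, growth, total, History.snoc, Fin.sum_univ_castSucc, Fin.snoc_castSucc,
    Fin.snoc_last]
  split_ifs
  · rw [mul_add, Real.exp_add]
    ring
  · simp only [add_zero]

theorem measurable_total (a : A) (j : J) (t : ℕ) : Measurable (E.total a j (t := t)) := by
  refine Finset.measurable_sum _ fun s _ => Measurable.ite ?_ ?_ measurable_const
  · exact measurableSet_eq_fun ((measurable_pi_apply s).comp measurable_fst) measurable_const
  · exact (E.measurable_gain a j).comp ((measurable_pi_apply s).comp measurable_snd)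

theorem measurable_weight (a : A) (j : J) (t : ℕ) : Measurable (E.weight a j (t := t)) :=
  (Real.measurable_exp.comp ((E.measurable_total a j t).const_mul _)).div_const _

theorem exists_abs_total_le (t : ℕ) : ∃ K, ∀ a j (h : History t), |E.total a j h| ≤ K := by
  obtain ⟨K, hK⟩ := E.exists_abs_gain_le
  refine ⟨t * K, fun a j h => (Finset.abs_sum_le_sum_abs _ _).trans ?_⟩
  have term_le (s : Fin t) : |if h.1 s = E.point a then E.gain a j (h.2 s) else 0| ≤ K := by
    split_ifs
    · exact hK a j _
    · exact abs_zero.trans_le ((abs_nonneg _).trans (hK a j (h.2 s)))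
  exact (Finset.sum_le_sum fun s _ => term_le s).trans (by simp)

/-- Blackwell's condition: against every finitely supported mixture of losses, some prediction
makes no expert's weight grow on average. -/
def Blackwell : Prop :=
  ∀ s : Finset Loss, ∀ c ∈ stdSimplex ℝ s, ∃ a, ∀ j, ∑ i, c i * E.growth a j i ≤ 0

/-- The experts dominate swapping with error `κ`: the regret of having predicted `point a` instead
of `q` is, for every loss, at most a fixed fraction of the gain of a fixed expert at `a`,
plus `κ`. -/
def Dominates (κ : ℝ) : Prop :=
  ∀ a (q : unitInterval), ∃ j, ∃ u ∈ Set.Icc (0 : ℝ) 1,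
    ∀ ℓ : Loss, ℓ.1 (E.point a) - ℓ.1 q ≤ u * E.gain a j ℓ + κ

theorem Blackwell.nonempty {E : ExpertFamily A J} (hE : E.Blackwell) : Nonempty A := by
  classical
  obtain ⟨a, -⟩ := hE {Classical.arbitrary Loss} _
    (single_mem_stdSimplex ℝ ⟨Classical.arbitrary Loss, Finset.mem_singleton_self _⟩)
  exact ⟨a⟩

theorem exists_abs_growth_le [Finite A] : ∃ G, ∀ a j ℓ, |E.growth a j ℓ| ≤ G := by
  obtain ⟨K, hK⟩ := E.exists_abs_gain_le
  obtain ⟨R, hR⟩ := (Set.finite_range E.rate).bddAbove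
  refine ⟨Real.exp (R * K), fun a j ℓ => ?_⟩
  have hrate : E.rate a ≤ R := hR (Set.mem_range_self a)
  have abs_exp_sub_one_le (x : ℝ) : |Real.exp x - 1| ≤ Real.exp |x| :=
    abs_le.2 ⟨by linarith [Real.exp_pos x, Real.one_le_exp (abs_nonneg x)],
      by linarith [Real.exp_le_exp.2 (le_abs_self x)]⟩
  calc |E.growth a j ℓ| ≤ Real.exp |E.rate a * E.gain a j ℓ| := abs_exp_sub_one_le _
    _ ≤ Real.exp (R * K) := by
        rw [abs_mul, abs_of_pos (E.rate_pos a)]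
        exact Real.exp_le_exp.2 (mul_le_mul hrate (hK a j ℓ) (abs_nonneg _)
          ((E.rate_pos a).le.trans hrate))

section Finite

variable [Fintype A] [Fintype J]

/-- The total weight of all experts, which bounds the swap regret and which the predictor
keeps from growing. -/
noncomputable def potential {t : ℕ} (h : History t) : ℝ := ∑ a, ∑ j, E.weight a j h

theorem potential_default : E.potential (default : History 0) =
    ∑ a, Fintype.card J / E.rate a := by
  simp [potential, weight, total, div_eq_mul_inv]

theorem potential_snoc_point {t : ℕ} (h : History t) (a : A) (ℓ : Loss) :
    E.potential (h.snoc (E.point a) ℓ) =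
      E.potential h + ∑ j, E.weight a j h * E.growth a j ℓ := by
  classical
  simp only [potential, weight_snoc, E.point_injective.eq_iff, Finset.sum_add_distrib,
    Finset.sum_ite_irrel, Finset.sum_const_zero, Finset.sum_ite_eq, Finset.mem_univ, if_true]

theorem measurable_potential (t : ℕ) : Measurable (E.potential (t := t)) :=
  Finset.measurable_sum _ fun a _ => Finset.measurable_sum _ fun j _ => E.measurable_weight a j t

theorem exists_abs_potential_le (t : ℕ) : ∃ K, ∀ h : History t, |E.potential h| ≤ K := by
  obtain ⟨K, hK⟩ := E.exists_abs_total_le t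
  refine ⟨∑ a, ∑ _j : J, Real.exp (E.rate a * K) / E.rate a, fun h => ?_⟩
  rw [potential, abs_of_nonneg (Finset.sum_nonneg fun a _ => Finset.sum_nonneg fun j _ =>
    E.weight_nonneg a j h)]
  gcongr with a _ j _
  have := E.rate_pos a
  unfold weight
  gcongr
  exact (le_abs_self _).trans (hK a j h)

variable {E}

theorem Dominates.swapRegret_le {κ : ℝ} (hκ : E.Dominates κ) {T : ℕ} (h : History T)
    (hpoint : ∀ t, h.1 t ∈ Set.range E.point) :
    swapRegret h.1 h.2 ≤ E.potential h + T * κ := by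
  classical
  refine ciSup_le fun σ => ?_
  choose j u hu hgain using fun a => hκ a (σ (E.point a))
  have round_le (t : Fin T) : (h.2 t).1 (h.1 t) - (h.2 t).1 (σ (h.1 t)) ≤
      ∑ a, u a * (if h.1 t = E.point a then E.gain a (j a) (h.2 t) else 0) + κ := by
    obtain ⟨a, ha⟩ := hpoint t
    simpa only [← ha, E.point_injective.eq_iff, mul_ite, mul_zero, Finset.sum_ite_eq,
      Finset.mem_univ, if_true] using hgain a (h.2 t)
  calc ∑ t, (h.2 t).1 (h.1 t) - ∑ t, (h.2 t).1 (σ (h.1 t))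
      ≤ ∑ t, (∑ a, u a * (if h.1 t = E.point a then E.gain a (j a) (h.2 t) else 0) + κ) := by
        rw [← Finset.sum_sub_distrib]
        exact Finset.sum_le_sum fun t _ => round_le t
    _ = ∑ a, u a * E.total a (j a) h + T * κ := by
        rw [Finset.sum_add_distrib, Finset.sum_comm]
        simp [total, Finset.mul_sum]
    _ ≤ E.potential h + T * κ := by
        gcongr
        refine Finset.sum_le_sum fun a _ => ?_
        exact (E.mul_total_le_weight a (j a) (hu a) h).trans
          (Finset.single_le_sum (fun j _ => E.weight_nonneg a j h) (Finset.mem_univ (j a)))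

theorem Blackwell.exists_mem_stdSimplex (hE : E.Blackwell) {w : A → J → ℝ}
    (hw : ∀ a j, 0 ≤ w a j) :
    ∃ ρ ∈ stdSimplex ℝ A, ∀ ℓ, ∑ a, ρ a * ∑ j, w a j * E.growth a j ℓ ≤ 0 := by
  have := hE.nonempty
  refine exists_mem_stdSimplex_forall_sum_mul_nonpos_of_finset
    (fun ℓ a => ∑ j, w a j * E.growth a j ℓ) fun s c hc => ?_
  obtain ⟨a, ha⟩ := hE s c hc
  refine ⟨a, ?_⟩
  calc ∑ i, c i * ∑ j, w a j * E.growth a j i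
      = ∑ j, w a j * ∑ i, c i * E.growth a j i := by
        simp only [Finset.mul_sum]
        rw [Finset.sum_comm]
        exact Finset.sum_congr rfl fun j _ => Finset.sum_congr rfl fun i _ => mul_left_comm _ _ _
    _ ≤ 0 := Finset.sum_nonpos fun j _ => mul_nonpos_of_nonneg_of_nonpos (hw a j) (ha j)

-- The minimax distribution is chosen separately for each value of the weights rounded down to
-- multiples of `ε`: these form a countable set, so the choice is measurable.
theorem Blackwell.exists_kernel (hE : E.Blackwell) {η : ℝ} (hη : 0 < η) (t : ℕ) :
    ∃ κ : Kernel (History t) unitInterval, IsMarkovKernel κ ∧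
      (∀ h, ∀ᵐ x ∂κ h, x ∈ Set.range E.point) ∧
      ∀ h ℓ, ∫ x, E.potential (h.snoc x ℓ) ∂κ h ≤ E.potential h + η := by
  obtain ⟨G, hG⟩ := E.exists_abs_growth_le
  let ε : ℝ := η / (Fintype.card J * |G| + 1)
  have hε : 0 < ε := by positivity
  choose ρ hρ hρ_growth using fun m : A → J → ℕ =>
    hE.exists_mem_stdSimplex (w := fun a j => m a j * ε) fun a j => by positivity
  choose μ hμ hμ_point hμ_integral using fun m =>
    exists_isProbabilityMeasure_integral_eq_sum (hρ m) E.point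
  let round (h : History t) (a : A) (j : J) : ℕ := ⌊E.weight a j h / ε⌋₊
  have measurable_round : Measurable round :=
    measurable_pi_lambda _ fun a => measurable_pi_lambda _ fun j =>
      Nat.measurable_floor.comp ((E.measurable_weight a j t).div_const ε)
  refine ⟨(Kernel.ofFunOfCountable μ).comap round measurable_round, ⟨fun h => hμ (round h)⟩,
    fun h => hμ_point (round h), fun h ℓ => ?_⟩
  have hmeas : Measurable fun x => E.potential (h.snoc x ℓ) :=
    (E.measurable_potential (t + 1)).comp
      (History.measurable_snoc.comp ((measurable_const (a := (h, ℓ))).prodMk measurable_id))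
  calc ∫ x, E.potential (h.snoc x ℓ) ∂μ (round h)
      = ∑ a, ρ (round h) a * E.potential (h.snoc (E.point a) ℓ) := hμ_integral _ _ hmeas
    _ = E.potential h + ∑ a, ρ (round h) a * ∑ j, E.weight a j h * E.growth a j ℓ := by
        simp only [potential_snoc_point, mul_add, Finset.sum_add_distrib, ← Finset.sum_mul,
          (hρ _).2, one_mul]
    _ ≤ E.potential h + (0 + Fintype.card J * (ε * |G|)) := by
        gcongr
        exact (sum_mul_sum_mul_le_of_abs_sub_le
          (fun a j => abs_sub_floor_div_mul_le (E.weight_nonneg a j h) hε)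
          (fun a j => (hG a j ℓ).trans (le_abs_self G)) (hρ _)).trans
          (add_le_add_left (hρ_growth _ ℓ) _)
    _ ≤ E.potential h + η := by
        have : ε * (Fintype.card J * |G| + 1) = η := div_mul_cancel₀ _ (by positivity)
        linarith

theorem exists_strategy_integral_swapRegret_le (hE : E.Blackwell) {κ : ℝ} (hκ : E.Dominates κ)
    {η : ℝ} (hη : 0 < η) (T : ℕ) :
    ∃ S : PredictionStrategy T, ∀ (Ω : Type*) [MeasurableSpace Ω] (P : Measure Ω)
      [IsProbabilityMeasure P] (p : Fin T → Ω → unitInterval) (ℓ : Fin T → Ω → Loss),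
      IsPlay S P p ℓ → ∫ ω, swapRegret (fun t => p t ω) (fun t => ℓ t ω) ∂P ≤
        ∑ a, Fintype.card J / E.rate a + T * (κ + η) := by
  choose ρ hρ hρ_point hρ_potential using hE.exists_kernel hη
  refine ⟨⟨fun t => ρ t, fun t => hρ t⟩, fun Ω _ P _ p ℓ hplay => ?_⟩
  let h (ω : Ω) : History T := transcript p ℓ le_rfl ω
  have hpoint : ∀ᵐ ω ∂P, ∀ t, p t ω ∈ Set.range E.point := ae_all_iff.2 fun t =>
    ae_mem_of_hasCondDistrib (hplay.prediction_law t) (Set.finite_range _).measurableSet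
      fun z => hρ_point t z.1
  obtain ⟨K, hK⟩ := E.exists_abs_potential_le T
  have integrable_potential : Integrable (fun ω => E.potential (h ω)) P :=
    Integrable.of_bound ((E.measurable_potential T).comp (measurable_transcript
      hplay.measurable_prediction hplay.measurable_loss le_rfl)).aestronglyMeasurable K
      (ae_of_all _ fun ω => hK (h ω))
  calc ∫ ω, swapRegret (fun t => p t ω) (fun t => ℓ t ω) ∂P
      ≤ ∫ ω, (E.potential (h ω) + T * κ) ∂P := by
        refine integral_mono_ae
          (integrable_swapRegret hplay.measurable_prediction hplay.measurable_loss)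
          (integrable_potential.add (integrable_const _)) ?_
        filter_upwards [hpoint] with ω hω
        exact hκ.swapRegret_le (h ω) hω
    _ = ∫ ω, E.potential (h ω) ∂P + T * κ := by
        rw [integral_add integrable_potential (integrable_const _)]
        simp only [integral_const, probReal_univ, one_smul]
    _ ≤ (E.potential (default : History 0) + T * η) + T * κ := by
        gcongr
        exact hplay.integral_transcript_le E.measurable_potential E.exists_abs_potential_le
          (fun t => hρ_potential t) le_rfl
    _ = ∑ a, Fintype.card J / E.rate a + T * (κ + η) := by
        rw [potential_default]
        ring

end Finite

end ExpertFamily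

section Mixture

variable {ι : Type*} [Fintype ι] {c : ι → ℝ} {f : ι → ℝ → ℝ}

theorem convexOn_sum_mul {s : Set ℝ} (hs : Convex ℝ s) (hc : ∀ i, 0 ≤ c i)
    (hf : ∀ i, ConvexOn ℝ s (f i)) : ConvexOn ℝ s fun x => ∑ i, c i * f i x := by
  have h := Finset.sum_induction (fun i x => c i * f i x) (ConvexOn ℝ s) (s := Finset.univ)
    (fun _ _ => ConvexOn.add) (convexOn_const 0 hs) fun i _ => (hf i).smul (hc i)
  convert h using 1
  exact (Finset.sum_fn _ _).symm

theorem lipschitzWith_sum_mul_of_mem_stdSimplex (hc : c ∈ stdSimplex ℝ ι) {K : NNReal}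
    (hf : ∀ i, LipschitzWith K (f i)) : LipschitzWith K fun x => ∑ i, c i * f i x := by
  refine LipschitzWith.of_dist_le_mul fun x y => ?_
  calc dist (∑ i, c i * f i x) (∑ i, c i * f i y)
      ≤ ∑ i, dist (c i * f i x) (c i * f i y) := dist_sum_sum_le _ _ _
    _ = ∑ i, c i * dist (f i x) (f i y) := by
        simp only [Real.dist_eq, ← mul_sub, abs_mul, abs_of_nonneg (hc.1 _)]
    _ ≤ ∑ i, c i * (K * dist x y) := by
        gcongr with i
        · exact hc.1 i
        · exact (hf i).dist_le_mul x y
    _ = K * dist x y := by rw [← Finset.sum_mul, hc.2, one_mul]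

end Mixture

/-- The accuracy `θ` up to which the buckets of `Bucket n` resolve the minimum of a loss: by
the Lipschitz condition, twice the width of the smallest buckets. -/
noncomputable def tolerance (n : ℕ) : ℝ := 2 * (1 / 2) ^ n

theorem tolerance_pos (n : ℕ) : 0 < tolerance n := by unfold tolerance; positivity

theorem tolerance_le_one {n : ℕ} (hn : n ≠ 0) : tolerance n ≤ 1 := by
  obtain ⟨m, rfl⟩ := Nat.exists_eq_succ_of_ne_zero hn
  have := pow_le_one₀ (n := m) (one_half_pos (α := ℝ)).le one_half_lt_one.le
  rw [tolerance, pow_succ]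
  linarith

namespace Bucket

variable {n : ℕ} (b : Bucket n)

theorem tolerance_le_two_mul_width : tolerance n ≤ 2 * b.width :=
  mul_le_mul_of_nonneg_left
    (pow_le_pow_of_le_one one_half_pos.le one_half_lt_one.le (Nat.lt_succ_iff.1 b.1.isLt))
    zero_le_two

/-- The score of the four experts of a bucket: the average decrease of the loss near the midpoint
in the direction `ε`, which bounds what is gained per unit length by a swap in that direction. The
expert `inl ε` watches swaps by at most `12` widths and measures the decrease behind the midpoint.
The expert `inr ε` watches longer swaps and measures it ahead; its score is `-1` if this would lead
out of `[0, 1]`, where there are no such swaps. -/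
noncomputable def score : ℤˣ ⊕ ℤˣ → (ℝ → ℝ) → ℝ
  | .inl ε, f => decrease f b.center ε (-(b.width / 2))
  | .inr ε, f =>
    if b.center + ε * (12 * b.width) ∈ Set.Icc (0 : ℝ) 1 then decrease f b.center ε (12 * b.width)
    else -1

/-- The part of the score that is not counted as gain: if the midpoint is optimal up to
`θ = tolerance n`, the expert `inl ε` may still have a score of `2 θ / b.width`. -/
noncomputable def drift : ℤˣ ⊕ ℤˣ → ℝ :=
  Sum.elim (fun _ => 3 * tolerance n / b.width) fun _ => 0

/-- The learning rate of the experts of a bucket. -/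
noncomputable def rate : ℝ := tolerance n / (12 * b.width)

theorem rate_pos : 0 < b.rate := div_pos (tolerance_pos n) (by linarith [b.width_pos])

theorem rate_le_one : b.rate ≤ 1 :=
  (div_le_one (by linarith [b.width_pos])).2
    (by linarith [b.width_pos, b.tolerance_le_two_mul_width])

theorem drift_mem_Icc (j : ℤˣ ⊕ ℤˣ) : b.drift j ∈ Set.Icc (0 : ℝ) 6 := by
  have := b.width_pos
  have := tolerance_pos n
  rcases j with _ | _
  · exact ⟨by dsimp only [drift, Sum.elim_inl]; positivity,
      (div_le_iff₀ b.width_pos).2 (by linarith [b.tolerance_le_two_mul_width])⟩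
  · norm_num [drift]

theorem abs_score_le_one {f : ℝ → ℝ} (hf : LipschitzWith 1 f) (j : ℤˣ ⊕ ℤˣ) :
    |b.score j f| ≤ 1 := by
  rcases j with ε | ε
  · exact abs_decrease_le _ _ _ hf
  · rw [score]
    split_ifs
    · exact abs_decrease_le _ _ _ hf
    · norm_num

theorem measurable_score_extend (j : ℤˣ ⊕ ℤˣ) :
    Measurable fun ℓ : Loss => b.score j ℓ.extend := by
  have measurable_decrease (x : ℝ) (ε : ℤˣ) (δ : ℝ) :
      Measurable fun ℓ : Loss => decrease ℓ.extend x ε δ :=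
    ((Loss.measurable_extend_apply x).sub (Loss.measurable_extend_apply _)).div_const δ
  rcases j with ε | ε
  · exact measurable_decrease _ _ _
  · simp only [score]
    split_ifs
    · exact measurable_decrease _ _ _
    · exact measurable_const

theorem score_sum_mul {ι : Type*} [Fintype ι] {c : ι → ℝ} (hc : ∑ i, c i = 1) (f : ι → ℝ → ℝ)
    (j : ℤˣ ⊕ ℤˣ) : b.score j (fun x => ∑ i, c i * f i x) = ∑ i, c i * b.score j (f i) := by
  rcases j with ε | ε
  · exact decrease_sum_mul _ _ _ _ _
  · simp only [score]
    split_ifs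
    · exact decrease_sum_mul _ _ _ _ _
    · rw [← Finset.sum_mul, hc, one_mul]

theorem add_units_mul_neg_half_width_mem_Icc (ε : ℤˣ) :
    b.center + ε * -(b.width / 2) ∈ Set.Icc (0 : ℝ) 1 := by
  refine b.Icc_subset_Icc_zero_one (Set.mem_Icc_iff_abs_le.1 ?_)
  rw [abs_sub_comm, abs_add_units_mul_sub, abs_neg, abs_of_pos (half_pos b.width_pos)]

theorem exists_score_le_drift_sub_rate {f : ℝ → ℝ} (hf : ConvexOn ℝ (Set.Icc 0 1) f)
    (hlip : LipschitzOnWith 1 f (Set.Icc 0 1)) (hn : n ≠ 0) :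
    ∃ b : Bucket n, ∀ j, b.score j f ≤ b.drift j - b.rate := by
  obtain ⟨b, hnear, hfar⟩ := exists_bucket_of_convexOn hf hlip (n := n) (θ := tolerance n) le_rfl
    (tolerance_le_one hn)
  have hw := b.width_pos
  have hθ := tolerance_pos n
  refine ⟨b, ?_⟩
  rintro (ε | ε)
  · have hz := hnear (b.center + ε * -(b.width / 2))
      (by rw [abs_add_units_mul_sub, abs_neg, abs_of_pos (half_pos hw)])
    calc b.score (.inl ε) f
        = 2 * (f (b.center + ε * -(b.width / 2)) - f b.center) / b.width := by
          rw [score, decrease]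
          field_simp
          ring
      _ ≤ (3 - 1 / 12) * tolerance n / b.width :=
          div_le_div_of_nonneg_right (by linarith) hw.le
      _ = b.drift (.inl ε) - b.rate := by
          rw [drift, rate, Sum.elim_inl]
          field_simp
  · rw [score, drift, Sum.elim_inr, zero_sub]
    split_ifs with hmem
    · have hz := hfar _ hmem
        (by rw [abs_add_units_mul_sub, abs_of_pos (mul_pos (by norm_num) hw)])
      rw [decrease, rate, ← neg_div]
      exact div_le_div_of_nonneg_right (by linarith) (by linarith)
    · exact neg_le_neg b.rate_le_one

theorem exists_forall_sub_le_mul_score (q : unitInterval) :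
    ∃ j, ∃ a ∈ Set.Icc (0 : ℝ) 1, a * b.drift j ≤ 36 * tolerance n ∧
      ∀ f, ConvexOn ℝ (Set.Icc 0 1) f → f b.center - f q ≤ a * b.score j f := by
  have hw := b.width_pos
  have hc := b.center_mem_Icc
  obtain ⟨ε, hε⟩ := exists_units_mul_abs_eq ((q : ℝ) - b.center)
  set a := |(q : ℝ) - b.center|
  have ha : a ∈ Set.Icc (0 : ℝ) 1 :=
    ⟨abs_nonneg _, abs_sub_le_of_le_of_le q.2.1 q.2.2 hc.1 hc.2 |>.trans_eq (sub_zero 1)⟩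
  have hq : (q : ℝ) = b.center + ε * a := by linarith
  have has : b.center + ε * a ∈ Set.Icc (0 : ℝ) 1 := hq ▸ q.2
  simp only [hq]
  rcases le_total a (12 * b.width) with hle | hle
  · refine ⟨.inl ε, a, ha, ?_, fun f hf => sub_le_mul_decrease ε hf hc
      (b.add_units_mul_neg_half_width_mem_Icc ε) has (by linarith) ha.1 (by linarith [ha.1])⟩
    rw [drift, Sum.elim_inl, ← mul_div_assoc, div_le_iff₀ hw]
    linarith [mul_le_mul_of_nonneg_right hle (tolerance_pos n).le]
  · have hmem : b.center + ε * (12 * b.width) ∈ Set.Icc (0 : ℝ) 1 := by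
      rcases Int.units_eq_one_or ε with rfl | rfl <;> push_cast at has ⊢ <;>
        constructor <;> linarith [has.1, has.2, hc.1, hc.2]
    refine ⟨.inr ε, a, ha, ?_, fun f hf => ?_⟩
    · rw [drift, Sum.elim_inr, mul_zero]
      exact mul_nonneg (by norm_num) (tolerance_pos n).le
    · rw [score, if_pos hmem]
      exact sub_le_mul_decrease ε hf hc hmem has (by linarith) ha.1 hle

end Bucket

/-- The experts of all buckets. -/
noncomputable def bucketExperts (n : ℕ) : ExpertFamily (Bucket n) (ℤˣ ⊕ ℤˣ) where
  point := Bucket.point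
  point_injective := Bucket.point_injective
  rate := Bucket.rate
  rate_pos := Bucket.rate_pos
  gain b j ℓ := b.score j ℓ.extend - b.drift j
  measurable_gain b j := (b.measurable_score_extend j).sub_const _
  exists_abs_gain_le := ⟨7, fun b j ℓ => by
    have hscore := abs_le.1 (b.abs_score_le_one ℓ.lipschitzWith_extend j)
    have hdrift := b.drift_mem_Icc j
    exact abs_le.2 ⟨by linarith [hscore.1, hdrift.2], by linarith [hscore.2, hdrift.1]⟩⟩

theorem bucketExperts_blackwell {n : ℕ} (hn : n ≠ 0) : (bucketExperts n).Blackwell := by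
  intro s c hc
  let f (x : ℝ) : ℝ := ∑ i, c i * i.1.extend x
  have hf : ConvexOn ℝ (Set.Icc 0 1) f :=
    convexOn_sum_mul (convex_Icc 0 1) hc.1 fun i => i.1.2.2
  have hlip : LipschitzWith 1 f :=
    lipschitzWith_sum_mul_of_mem_stdSimplex hc fun i => i.1.lipschitzWith_extend
  obtain ⟨b, hb⟩ := Bucket.exists_score_le_drift_sub_rate hf hlip.lipschitzOnWith hn
  exact ⟨b, fun j => sum_mul_exp_sub_one_nonpos hc
    (fun i => b.abs_score_le_one i.1.lipschitzWith_extend j) b.rate_pos.le b.rate_le_one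
    ((b.score_sum_mul hc.2 _ j).symm.trans_le (hb j))⟩

theorem bucketExperts_dominates (n : ℕ) : (bucketExperts n).Dominates (36 * tolerance n) := by
  intro b q
  obtain ⟨j, a, ha, hdrift, hscore⟩ := b.exists_forall_sub_le_mul_score q
  refine ⟨j, a, ha, fun ℓ => ?_⟩
  calc ℓ.1 b.point - ℓ.1 q = ℓ.extend b.center - ℓ.extend q := by
        rw [← ℓ.extend_coe, ← ℓ.extend_coe]; rfl
    _ ≤ a * b.score j ℓ.extend := hscore _ ℓ.2.2
    _ ≤ a * (b.score j ℓ.extend - b.drift j) + 36 * tolerance n := by linarith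

theorem sum_card_div_rate_bucketExperts (n : ℕ) :
    ∑ b, Fintype.card (ℤˣ ⊕ ℤˣ) / (bucketExperts n).rate b = 24 * (n + 1) * 2 ^ n := by
  calc ∑ b, Fintype.card (ℤˣ ⊕ ℤˣ) / (bucketExperts n).rate b
      = ∑ b : Bucket n, 48 / tolerance n * b.width := by
        refine Finset.sum_congr rfl fun b _ => ?_
        have hcard : (Fintype.card (ℤˣ ⊕ ℤˣ) : ℝ) = 4 := by simp
        change _ / b.rate = _
        rw [hcard, Bucket.rate, div_div_eq_mul_div]
        ring
    _ = 24 * (n + 1) * 2 ^ n := by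
        rw [← Finset.mul_sum, Bucket.sum_width, tolerance, one_div, inv_pow]
        field_simp
        norm_num

theorem exists_strategy_integral_swapRegret_le {n : ℕ} (hn : n ≠ 0) (T : ℕ) :
    ∃ S : PredictionStrategy T, ∀ (Ω : Type*) [MeasurableSpace Ω] (P : Measure Ω)
      [IsProbabilityMeasure P] (p : Fin T → Ω → unitInterval) (ℓ : Fin T → Ω → Loss),
      IsPlay S P p ℓ → ∫ ω, swapRegret (fun t => p t ω) (fun t => ℓ t ω) ∂P ≤
        24 * (n + 1) * 2 ^ n + 74 * (T / 2 ^ n) := by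
  obtain ⟨S, hS⟩ := ExpertFamily.exists_strategy_integral_swapRegret_le
    (bucketExperts_blackwell hn) (bucketExperts_dominates n) (tolerance_pos n) T
  refine ⟨S, fun Ω _ P _ p ℓ hplay => (hS Ω P p ℓ hplay).trans_eq ?_⟩
  rw [sum_card_div_rate_bucketExperts, tolerance, one_div, inv_pow]
  ring

theorem one_le_two_mul_log {x : ℝ} (hx : 2 ≤ x) : 1 ≤ 2 * Real.log x := by
  linarith [Real.log_two_gt_d9, Real.log_le_log two_pos hx]

theorem exists_two_pow_near_sqrt {T : ℕ} (hT : 2 ≤ T) : ∃ n : ℕ, n ≠ 0 ∧ √(T : ℝ) ≤ 2 ^ n ∧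
    (2 : ℝ) ^ n ≤ 2 * √T ∧ (n + 1 : ℝ) ≤ 5 * Real.log T := by
  let k := Nat.log 2 (Nat.sqrt T)
  have hpow_le : (2 : ℝ) ^ k ≤ √T :=
    calc (2 : ℝ) ^ k ≤ Nat.sqrt T := by
          exact_mod_cast Nat.pow_log_le_self 2 (Nat.sqrt_pos.2 (by omega)).ne'
      _ ≤ √T := Real.nat_sqrt_le_real_sqrt
  have hle_pow : √(T : ℝ) ≤ 2 ^ (k + 1) :=
    calc √(T : ℝ) ≤ Nat.sqrt T + 1 := Real.real_sqrt_le_nat_sqrt_succ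
      _ ≤ 2 ^ (k + 1) := by exact_mod_cast Nat.lt_pow_succ_log_self one_lt_two _
  have hk : (k : ℝ) ≤ Real.log T :=
    calc (k : ℝ) ≤ k * (2 * Real.log 2) := le_mul_of_one_le_right (Nat.cast_nonneg k)
          (one_le_two_mul_log le_rfl)
      _ = 2 * Real.log (2 ^ k) := by rw [Real.log_pow]; ring
      _ ≤ 2 * Real.log √T := by gcongr
      _ = Real.log T := by rw [Real.log_sqrt (Nat.cast_nonneg T)]; ring
  refine ⟨k + 1, k.succ_ne_zero, hle_pow, by rw [pow_succ]; linarith, ?_⟩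
  push_cast
  linarith [one_le_two_mul_log (x := T) (by exact_mod_cast hT)]

end SwapRegret

theorem mainTheorem3 :
    ∃ C : ℝ, 0 < C ∧ ∀ T : ℕ, 2 ≤ T →
      ∃ S : SwapRegret.PredictionStrategy T,
        ∀ (Ω : Type*) [MeasurableSpace Ω] (P : Measure Ω) [IsProbabilityMeasure P]
          (p : Fin T → Ω → unitInterval) (ℓ : Fin T → Ω → SwapRegret.Loss),
          SwapRegret.IsPlay S P p ℓ →
            Integrable (fun ω => SwapRegret.swapRegret (fun t => p t ω) (fun t => ℓ t ω)) P ∧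
            ∫ ω, SwapRegret.swapRegret (fun t => p t ω) (fun t => ℓ t ω) ∂P
              ≤ C * (Real.sqrt T * Real.log T) := by
  refine ⟨388, by norm_num, fun T hT => ?_⟩
  obtain ⟨n, hn, hlower, hupper, hlog⟩ := SwapRegret.exists_two_pow_near_sqrt hT
  obtain ⟨S, hS⟩ := SwapRegret.exists_strategy_integral_swapRegret_le hn T
  refine ⟨S, fun Ω _ P _ p ℓ hplay => ⟨SwapRegret.integrable_swapRegret
    hplay.measurable_prediction hplay.measurable_loss, (hS Ω P p ℓ hplay).trans ?_⟩⟩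
  have hdiv : (T : ℝ) / 2 ^ n ≤ √T := (div_le_iff₀ (by positivity)).2 <|
    calc (T : ℝ) = √T * √T := (Real.mul_self_sqrt (Nat.cast_nonneg T)).symm
      _ ≤ √T * 2 ^ n := by gcongr
  have hlogT : 1 ≤ 2 * Real.log T := SwapRegret.one_le_two_mul_log (by exact_mod_cast hT)
  calc 24 * (n + 1 : ℝ) * 2 ^ n + 74 * (T / 2 ^ n)
      ≤ 24 * (5 * Real.log T) * (2 * √T) + 74 * (1 * √T) := by rw [one_mul]; gcongr
    _ ≤ 24 * (5 * Real.log T) * (2 * √T) + 74 * (2 * Real.log T * √T) := by gcongr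
    _ = 388 * (√T * Real.log T) := by ring
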